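/- Theorem 8.4 (presentation of $\mathfrak o^{(1)}_I(2n)$). Let $K$ be a field of characteristic $2$ and let $n\ge 2$. Let $\mathfrak o_I(2n)$ be the Lie algebra of $2n\times 2n$ matrices over $K$ that preserve the symmetric bilinear form with Gram matrix $1_{2n}$ (that is, $A^T=-A$; in characteristic $2$ these are the symmetric matrices), and let $\mathfrak o^{(1)}_I(2n)=[\mathfrak o_I(2n),\mathfrak o_I(2n)]$ be its derived algebra. Then $\mathfrak o^{(1)}_I(2n)$ consists of exactly the symmetric $2n\times 2n$ matrices with zero diagonal. It is generated by the matrices $X_i=E_{i,i+1}+E_{i+1,i}$, $1\le i\le 2n-1$, and the following are defining relations for these generators: $$[X_i,X_j]=0\quad\text{for } 1\le i,j\le 2n-1,\ |i-j|\ge 2;$$ $$[X_i,[X_i,X_{i+1}]]=X_{i+1},\qquad [X_{i+1},[X_i,X_{i+1}]]=X_i\quad\text{for } 1\le i\le 2n-2;$$ $$[[X_{i-1},X_i],[X_i,X_{i+1}]]=0\quad\text{for } 2\le i\le 2n-2.$$ That is, if $F$ is the free Lie algebra over $K$ on $x_1,\dots,x_{2n-1}$ and $J\subset F$ is the ideal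 generated by the corresponding relators, there is an isomorphism of Lie algebras $F/J\to\mathfrak o^{(1)}_I(2n)$ that sends the class of $x_i$ to $X_i$ for every $i$. -/

import Mathlib

namespace OrthogonalPresentation

/-- The orthogonal Lie algebra `𝔬_I(2n)` of the symmetric bilinear form with Gram matrix `1`:
all matrices `A` with `Aᵀ = -A`.  In characteristic 2 these are the symmetric matrices. -/
abbrev oI (K : Type*) [Field K] (n : ℕ) :=
  LieAlgebra.Orthogonal.so (Fin (2 * n)) K

/-- `𝔬_I^{(1)}(2n)`: the (first) derived algebra of `𝔬_I(2n)`. -/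
abbrev oI1 (K : Type*) [Field K] (n : ℕ) : LieIdeal K (oI K n) :=
  LieAlgebra.derivedSeries K (oI K n) 1

/-- The matrix `X_i = E_{i,i+1} + E_{i+1,i}`; the index `i` runs over `2n - 1` values and is
counted from `0` instead of `1`. -/
def X (K : Type*) [Field K] (n : ℕ) (i : Fin (2 * n - 1)) :
    Matrix (Fin (2 * n)) (Fin (2 * n)) K :=
  Matrix.single ⟨i, by omega⟩ ⟨i + 1, by omega⟩ 1 +
    Matrix.single ⟨i + 1, by omega⟩ ⟨i, by omega⟩ 1

/-- The free Lie algebra on `2n - 1` generators. -/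
abbrev Free (K : Type*) [Field K] (n : ℕ) := FreeLieAlgebra K (Fin (2 * n - 1))

/-- The free generators. -/
noncomputable abbrev x (K : Type*) [Field K] (n : ℕ) (i : Fin (2 * n - 1)) : Free K n :=
  FreeLieAlgebra.of K i

/-- The relators: the relation `a = b` is encoded as the element `a - b` of the free Lie algebra.
In the constructors, `j = i + 1` (and `k = j + 1`) are consecutive indices. -/
inductive Relator (K : Type*) [Field K] (n : ℕ) : Free K n → Prop
  | comm (i j : Fin (2 * n - 1)) (h : (i : ℕ) + 2 ≤ j ∨ (j : ℕ) + 2 ≤ i) :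
      Relator K n ⁅x K n i, x K n j⁆
  | left (i j : Fin (2 * n - 1)) (h : (j : ℕ) = i + 1) :
      Relator K n (⁅x K n i, ⁅x K n i, x K n j⁆⁆ - x K n j)
  | right (i j : Fin (2 * n - 1)) (h : (j : ℕ) = i + 1) :
      Relator K n (⁅x K n j, ⁅x K n i, x K n j⁆⁆ - x K n i)
  | triple (i j k : Fin (2 * n - 1)) (hij : (j : ℕ) = i + 1) (hjk : (k : ℕ) = j + 1) :
      Relator K n ⁅⁅x K n i, x K n j⁆, ⁅x K n j, x K n k⁆⁆

/-- The ideal of the free Lie algebra generated by the relators. -/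
noncomputable abbrev relIdeal (K : Type*) [Field K] (n : ℕ) : LieIdeal K (Free K n) :=
  LieSubmodule.lieSpan K (Free K n) {r | Relator K n r}

/-- The Lie algebra given by the generators and relations. -/
abbrev Presented (K : Type*) [Field K] (n : ℕ) := Free K n ⧸ relIdeal K n

/-- The image of the `i`-th generator in the presented Lie algebra. -/
noncomputable abbrev gen (K : Type*) [Field K] (n : ℕ) (i : Fin (2 * n - 1)) : Presented K n :=
  LieSubmodule.Quotient.mk (x K n i)

end OrthogonalPresentation

namespace OrthogonalPresentation

/-! The iterated bracket `chain g a d` of consecutive generators is the abstract counterpart of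
`symUnit` at position `(a, a + d + 1)`. By the relations, bracketing a chain with a generator
lengthens it at an end, shortens it at an end, or gives zero (`lie_chain_mem`). So the span of the
chains is stable under the generators, and it is the whole presented algebra
(`presented_mem_span_chain`).

The matrices `X_i` satisfy the relations, so the presented algebra maps to the derived algebra,
sending each chain to its `symUnit`. These matrices span the symmetric zero-diagonal matrices, which
gives surjectivity. Reading off the entries above the diagonal returns each chain, which gives
injectivity. -/

/-- The presentation relations for the first `N` terms of a sequence in a Lie ring with symmetric
bracket. -/
structure ChainRelations {L : Type*} [LieRing L] (g : ℕ → L) (N : ℕ) : Prop where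
  symm : ∀ x y : L, ⁅x, y⁆ = ⁅y, x⁆
  comm : ∀ i j, i + 2 ≤ j → j < N → ⁅g i, g j⁆ = 0
  left : ∀ i, i + 1 < N → ⁅g i, ⁅g i, g (i + 1)⁆⁆ = g (i + 1)
  right : ∀ i, i + 1 < N → ⁅g (i + 1), ⁅g i, g (i + 1)⁆⁆ = g i
  triple : ∀ i, i + 2 < N → ⁅⁅g i, g (i + 1)⁆, ⁅g (i + 1), g (i + 2)⁆⁆ = 0

/-- The iterated left-normed bracket `[…[g a, g (a + 1)], …, g (a + d)]`. -/
def chain {L : Type*} [LieRing L] (g : ℕ → L) (a : ℕ) : ℕ → L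
  | 0 => g a
  | d + 1 => ⁅chain g a d, g (a + d + 1)⁆

/-! ### Brackets of a generator with a chain. -/

namespace ChainRelations

variable {L : Type*} [LieRing L] {g : ℕ → L} {N : ℕ}

theorem lie_chain_of_lt (h : ChainRelations g N) {i a d : ℕ} (hi : i + 2 ≤ a) (hd : a + d < N) :
    ⁅g i, chain g a d⁆ = 0 := by
  induction d with
  | zero => exact h.comm i a hi hd
  | succ d ih =>
    rw [chain, leibniz_lie, ih (by omega), h.comm i (a + d + 1) (by omega) hd]
    simp

theorem lie_chain_of_gt (h : ChainRelations g N) {i a d : ℕ} (hi : a + d + 2 ≤ i) (hN : i < N) :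
    ⁅g i, chain g a d⁆ = 0 := by
  induction d with
  | zero => rw [h.symm]; exact h.comm a i hi hN
  | succ d ih =>
    rw [chain, leibniz_lie, ih (by omega), h.symm (g i), h.comm _ i (by omega) hN]
    simp

theorem lie_chain_extend_left (h : ChainRelations g N) {a d : ℕ} (hd : a + 1 + d < N) :
    ⁅g a, chain g (a + 1) d⁆ = chain g a (d + 1) := by
  induction d with
  | zero => rfl
  | succ d ih =>
    rw [chain, leibniz_lie, ih (by omega), h.comm a (a + 1 + d + 1) (by omega) hd, lie_zero, add_zero,
      chain.eq_2 g a (d + 1), show a + 1 + d + 1 = a + (d + 1) + 1 by omega]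

theorem lie_chain_truncate_left (h : ChainRelations g N) {a d : ℕ} (hd : a + 1 + d < N) :
    ⁅g a, chain g a (d + 1)⁆ = chain g (a + 1) d := by
  induction d with
  | zero => exact h.left a hd
  | succ d ih =>
    rw [chain, leibniz_lie, ih (by omega), h.comm a _ (by omega) (by omega), lie_zero, add_zero,
      chain.eq_2 g (a + 1) d, show a + 1 + d + 1 = a + (d + 1) + 1 by omega]

/-- The last generator commutes with all but the last two factors, so its adjoint action passes
inside to those two, where `right` applies. -/
theorem lie_chain_truncate_right (h : ChainRelations g N) {a d : ℕ} (hd : a + d + 1 < N) :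
    ⁅g (a + d + 1), chain g a (d + 1)⁆ = chain g a d := by
  cases d with
  | zero => exact h.right a hd
  | succ d =>
    have hf := h.lie_chain_of_gt (g := g) (i := a + (d + 1) + 1) (a := a) (d := d) (by omega) hd
    rw [chain, chain, h.symm ⁅chain g a d, _⁆, leibniz_lie (g (a + (d + 1) + 1)) (chain g a d), hf,
      zero_lie, zero_add, leibniz_lie, hf, zero_lie, zero_add, h.symm (g (a + (d + 1) + 1)) (g _),
      show a + (d + 1) + 1 = (a + d + 1) + 1 by omega, h.right _ (by omega)]

/-- By induction only the last-but-one generator matters, and this is where `triple` enters. -/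
theorem lie_chain_interior (h : ChainRelations g N) {i a d : ℕ} (ha : a < i) (hi : i < a + d)
    (hd : a + d < N) : ⁅g i, chain g a d⁆ = 0 := by
  induction d with
  | zero => omega
  | succ d ih =>
    rcases Nat.lt_or_ge i (a + d) with hlt | hge
    · rw [chain, leibniz_lie, ih hlt (by omega), h.comm i (a + d + 1) (by omega) hd]
      simp
    · obtain rfl : i = a + d := by omega
      cases d with
      | zero => omega
      | succ d =>
        -- The Leibniz rule leaves two terms: `h1` kills the one where the generator has shortened
        -- the inner chain, `h2` the one where it has met the last factor.
        have h1 : ⁅chain g a d, g (a + (d + 1) + 1)⁆ = 0 := by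
          rw [h.symm]; exact h.lie_chain_of_gt (by omega) hd
        have h2 : ⁅chain g a (d + 1), ⁅g (a + (d + 1)), g (a + (d + 1) + 1)⁆⁆ = 0 := by
          cases d with
          | zero => exact h.triple a (by omega)
          | succ d =>
            have hf : ∀ j, a + d + 2 ≤ j → j < N → ⁅chain g a d, g j⁆ = 0 := fun j hj hjN => by
              rw [h.symm]; exact h.lie_chain_of_gt hj hjN
            -- Regrouping the last two factors exposes the left half of a `triple` relation; the
            -- remaining prefix commutes with the right half.
            have e : chain g a (d + 1 + 1) =
                ⁅chain g a d, ⁅g (a + d + 1), g (a + (d + 1) + 1)⁆⁆ := by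
              rw [chain, chain, leibniz_lie, hf (a + (d + 1) + 1) (by omega) (by omega), lie_zero, add_zero]
            have hc : ⁅chain g a d, ⁅g (a + (d + 1 + 1)), g (a + (d + 1 + 1) + 1)⁆⁆ = 0 := by
              rw [leibniz_lie, hf _ (by omega) (by omega), hf _ (by omega) (by omega)]
              simp
            have ht := h.triple (a + d + 1) (by omega)
            rw [e, lie_lie, hc, lie_zero, sub_zero]
            rw [show a + (d + 1) + 1 = a + d + 1 + 1 by omega,
              show a + (d + 1 + 1) = a + d + 1 + 1 by omega,
              show a + d + 1 + 1 + 1 = a + d + 1 + 2 by omega, ht, lie_zero]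
        have h3 := h.lie_chain_truncate_right (a := a) (d := d) (by omega)
        rw [chain, leibniz_lie, show a + (d + 1) = a + d + 1 by omega, h3]
        rw [show a + d + 1 = a + (d + 1) by omega, h1, h2, zero_add]

theorem lie_chain_mem (h : ChainRelations g N) {S : AddSubgroup L}
    (hS : ∀ a d, a + d < N → chain g a d ∈ S) {i a d : ℕ} (hi : i < N) (hd : a + d < N) :
    ⁅g i, chain g a d⁆ ∈ S := by
  rcases Nat.lt_or_ge (i + 1) a with h1 | h1
  · rw [h.lie_chain_of_lt h1 hd]; exact S.zero_mem
  rcases h1.eq_or_lt with rfl | h1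
  · rw [h.lie_chain_extend_left hd]; exact hS _ _ (by omega)
  rcases Nat.lt_or_ge (a + d + 1) i with h2 | h2
  · rw [h.lie_chain_of_gt h2 hi]; exact S.zero_mem
  rcases h2.eq_or_lt with rfl | h2
  · rw [h.symm]; exact hS a (d + 1) hi
  rcases (show a ≤ i by omega).eq_or_lt with rfl | h3
  · cases d with
    | zero => rw [chain, lie_self]; exact S.zero_mem
    | succ d => rw [h.lie_chain_truncate_left (by omega)]; exact hS _ _ (by omega)
  rcases (show i ≤ a + d by omega).eq_or_lt with rfl | h4
  · cases d with
    | zero => omega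
    | succ d => rw [← add_assoc, h.lie_chain_truncate_right (by omega)]; exact hS _ _ (by omega)
  · rw [h.lie_chain_interior h3 h4 hd]; exact S.zero_mem

end ChainRelations

open Matrix

/-! ### Matrix computations with `symUnit`. -/

section Matrices
variable {K : Type*} [Field K] {m : Type*} [DecidableEq m]

/-- The matrix `E_{a,b} + E_{b,a}`. -/
def symUnit (K : Type*) [Field K] {m : Type*} [DecidableEq m] (a b : m) : Matrix m m K :=
  single a b 1 + single b a 1

theorem symUnit_comm (a b : m) : symUnit K a b = symUnit K b a := add_comm _ _

theorem symUnit_isSymm (a b : m) : (symUnit K a b).IsSymm := by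
  simp [Matrix.IsSymm, symUnit, add_comm]

omit [DecidableEq m] in
theorem matrix_sub_eq_add [CharP K 2] (A B : Matrix m m K) : A - B = A + B := by
  ext i j
  exact CharTwo.sub_eq_add _ _

variable [Fintype m]

theorem symUnit_lie_adjacent [CharP K 2] {a b c : m} (hab : a ≠ b) (hbc : b ≠ c) (hac : a ≠ c) :
    ⁅symUnit K a b, symUnit K b c⁆ = symUnit K a c := by
  simp [symUnit, Ring.lie_def, add_mul, mul_add, hab, hbc, hac, hab.symm, hbc.symm, hac.symm,
    matrix_sub_eq_add]

theorem symUnit_lie_disjoint {a b c d : m} (hac : a ≠ c) (had : a ≠ d) (hbc : b ≠ c)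
    (hbd : b ≠ d) : ⁅symUnit K a b, symUnit K c d⁆ = 0 := by
  simp [symUnit, Ring.lie_def, add_mul, mul_add, hac, had, hbc, hbd, hac.symm, had.symm, hbc.symm,
    hbd.symm]

theorem single_diag_lie_symUnit [CharP K 2] {a b : m} (hab : a ≠ b) :
    ⁅(single a a 1 : Matrix m m K), symUnit K a b⁆ = symUnit K a b := by
  simp [symUnit, Ring.lie_def, add_mul, mul_add, hab, hab.symm, matrix_sub_eq_add]

-- For symmetric matrices, `A * B` and `B * A` are transposes of each other and so share a diagonal.
omit [DecidableEq m] in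
theorem isSymm_lie_diag {A B : Matrix m m K} (hA : A.IsSymm) (hB : B.IsSymm) (i : m) :
    ⁅A, B⁆ i i = 0 := by
  rw [Ring.lie_def, Matrix.sub_apply, Matrix.mul_apply, Matrix.mul_apply, ← Finset.sum_sub_distrib]
  refine Finset.sum_eq_zero fun j _ => ?_
  rw [hA.apply, hB.apply, mul_comm, sub_self]

theorem eq_sum_symUnit [LinearOrder m] {A : Matrix m m K} (hA : A.IsSymm) (h0 : ∀ i, A i i = 0) :
    A = ∑ i, ∑ j, if i < j then A i j • symUnit K i j else 0 := by
  ext p q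
  have key : (∑ i, ∑ j, if i < j then A i j • symUnit K i j else 0) p q =
      (if p < q then A p q else 0) + (if q < p then A q p else 0) := by
    have : ∀ i j, (if i < j then A i j • symUnit K i j else 0) p q =
        (if i = p then if j = q then (if i < j then A i j else 0) else 0 else 0) +
        (if j = p then if i = q then (if i < j then A i j else 0) else 0 else 0) := by
      intro i j
      by_cases hij : i < j
      · simp only [hij, if_true, symUnit, Matrix.smul_apply, Matrix.add_apply, Matrix.single_apply,
          smul_eq_mul, mul_add, mul_ite, mul_one, mul_zero, ite_and]
      · simp [hij]
    simp only [Matrix.sum_apply, this, Finset.sum_add_distrib]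
    simp
  rw [key]
  rcases lt_trichotomy p q with h | rfl | h
  · simp [h, h.not_gt]
  · simp [h0]
  · simp [h, h.not_gt, hA.apply]

end Matrices

/-! ### The derived algebra as symmetric zero-diagonal matrices. -/

section CharTwo
variable {K : Type*} [Field K] [CharP K 2]

theorem lie_comm_of_charTwo {L : Type*} [LieRing L] [LieAlgebra K L] (x y : L) :
    ⁅x, y⁆ = ⁅y, x⁆ := by
  rw [← lie_skew, ← neg_one_smul K, CharTwo.neg_eq (1 : K), one_smul]

theorem mem_so_iff_isSymm {m : Type*} [Fintype m] [DecidableEq m] {A : Matrix m m K} :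
    A ∈ LieAlgebra.Orthogonal.so m K ↔ A.IsSymm := by
  have : -A = A := by ext i j; simp [CharTwo.neg_eq]
  rw [LieAlgebra.Orthogonal.mem_so, this, Matrix.IsSymm]

variable {n : ℕ}

omit [CharP K 2] in
theorem mem_oI1_iff {a : oI K n} :
    a ∈ oI1 K n ↔ a ∈ Submodule.span K {⁅x, y⁆ | (x : oI K n) (y : oI K n)} := by
  rw [← LieAlgebra.coe_derivedSeries_one_eq]
  rfl

/-- In characteristic 2 the diagonal unit `E_{a,a}` lies in `oI`, and its bracket with `symUnit K a
b` gives that matrix back. -/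
theorem symUnit_mem_derived {a b : Fin (2 * n)} (hab : a ≠ b) :
    (⟨symUnit K a b, mem_so_iff_isSymm.2 (symUnit_isSymm a b)⟩ : oI K n) ∈ oI1 K n := by
  have hs : (single a a 1 : Matrix (Fin (2 * n)) (Fin (2 * n)) K) ∈
      LieAlgebra.Orthogonal.so (Fin (2 * n)) K := mem_so_iff_isSymm.2 (by simp [Matrix.IsSymm])
  rw [mem_oI1_iff]
  refine Submodule.subset_span ⟨⟨_, hs⟩, ⟨symUnit K a b, mem_so_iff_isSymm.2 (symUnit_isSymm a b)⟩,
    Subtype.ext (single_diag_lie_symUnit hab)⟩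

/-- The inclusion of the derived algebra into the matrices. -/
def oI1Incl (K : Type*) [Field K] (n : ℕ) :
    oI1 K n →ₗ[K] Matrix (Fin (2 * n)) (Fin (2 * n)) K where
  toFun a := a.1.1
  map_add' _ _ := rfl
  map_smul' _ _ := rfl

omit [CharP K 2] in
theorem oI1Incl_injective : Function.Injective (oI1Incl K n) :=
  fun _ _ h => Subtype.ext (Subtype.ext h)

omit [CharP K 2] in
theorem oI1Incl_lie (a b : oI1 K n) : oI1Incl K n ⁅a, b⁆ = ⁅oI1Incl K n a, oI1Incl K n b⁆ := rfl

theorem oI1Incl_isSymm (a : oI1 K n) : (oI1Incl K n a).IsSymm := mem_so_iff_isSymm.1 a.1.2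

theorem oI1Incl_diag (a : oI1 K n) (i : Fin (2 * n)) : oI1Incl K n a i i = 0 := by
  obtain ⟨a, ha'⟩ := a
  have ha := mem_oI1_iff.1 ha'
  change a.1 i i = 0
  clear ha'
  induction ha using Submodule.span_induction with
  | mem x hx =>
    obtain ⟨y, z, rfl⟩ := hx
    exact isSymm_lie_diag (mem_so_iff_isSymm.1 y.2) (mem_so_iff_isSymm.1 z.2) i
  | zero => rfl
  | add x y _ _ hx hy => exact (congrArg₂ (· + ·) hx hy).trans (add_zero 0)
  | smul c x _ hx => exact (congrArg (c * ·) hx).trans (mul_zero c)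

/-- `E_{a,b} + E_{b,a}` as an element of the derived algebra. -/
def symUnitDerived (K : Type*) [Field K] [CharP K 2] {n : ℕ} {a b : Fin (2 * n)} (hab : a ≠ b) :
    oI1 K n := ⟨_, symUnit_mem_derived hab⟩

@[simp]
theorem oI1Incl_symUnitDerived {a b : Fin (2 * n)} (hab : a ≠ b) :
    oI1Incl K n (symUnitDerived K hab) = symUnit K a b := rfl

theorem exists_oI1Incl_eq_iff (A : Matrix (Fin (2 * n)) (Fin (2 * n)) K) :
    (∃ a, oI1Incl K n a = A) ↔ A.IsSymm ∧ ∀ i, A i i = 0 := by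
  refine ⟨?_, fun ⟨hs, h0⟩ => ?_⟩
  · rintro ⟨a, rfl⟩
    exact ⟨oI1Incl_isSymm a, oI1Incl_diag a⟩
  · change A ∈ LinearMap.range (oI1Incl K n)
    rw [eq_sum_symUnit hs h0]
    refine Submodule.sum_mem _ fun i _ => Submodule.sum_mem _ fun j _ => ?_
    split_ifs with hij
    · exact Submodule.smul_mem _ _ ⟨symUnitDerived K hij.ne, rfl⟩
    · exact Submodule.zero_mem _

end CharTwo

/-! ### Chains span the presented algebra. -/

section Presentation
variable {K : Type*} [Field K] {n : ℕ}

theorem presented_lieSubalgebra_eq_top (H : LieSubalgebra K (Presented K n))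
    (hH : ∀ i, gen K n i ∈ H) (z : Presented K n) : z ∈ H := by
  obtain ⟨y, rfl⟩ := LieSubmodule.Quotient.surjective_mk' _ z
  let π : Free K n →ₗ⁅K⁆ Presented K n :=
    { (LieSubmodule.Quotient.mk' (relIdeal K n) : Free K n →ₗ[K] Presented K n) with
      map_lie' := fun {x y} => LieSubmodule.Quotient.mk_bracket (I := relIdeal K n) x y }
  let F : Free K n →ₗ⁅K⁆ H := FreeLieAlgebra.lift K fun i => ⟨gen K n i, hH i⟩
  -- Both maps agree on the free generators, so the quotient map factors through `H`.
  have h : H.incl.comp F = π := by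
    apply FreeLieAlgebra.hom_ext
    intro i
    simp only [LieHom.comp_apply, F, FreeLieAlgebra.lift_of_apply]
    rfl
  have h2 : π y = (F y : Presented K n) := (LieHom.congr_fun h y).symm
  change π y ∈ H
  rw [h2]
  exact (F y).2

/-- A subspace containing the generators and stable under bracketing with them is everything. -/
theorem presented_submodule_eq_top (S : Submodule K (Presented K n)) (hS : ∀ i, gen K n i ∈ S)
    (hb : ∀ i, ∀ s ∈ S, ⁅gen K n i, s⁆ ∈ S) (z : Presented K n) : z ∈ S := by
  -- The elements whose adjoint action preserves `S` form a subalgebra containing the generators,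
  -- hence everything; so `S` is itself a subalgebra.
  let H : LieSubalgebra K (Presented K n) :=
    { carrier := {z | ∀ s ∈ S, ⁅z, s⁆ ∈ S}
      add_mem' := fun {a b} ha hb s hs => by rw [add_lie]; exact S.add_mem (ha s hs) (hb s hs)
      zero_mem' := fun s _ => by rw [zero_lie]; exact S.zero_mem
      smul_mem' := fun c a ha s hs => by rw [smul_lie]; exact S.smul_mem c (ha s hs)
      lie_mem' := fun {a b} ha hb s hs => by
        rw [lie_lie]; exact S.sub_mem (ha _ (hb s hs)) (hb _ (ha s hs)) }
  let T : LieSubalgebra K (Presented K n) :=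
    { S with lie_mem' := fun {a b} _ hs => presented_lieSubalgebra_eq_top H hb a b hs }
  exact presented_lieSubalgebra_eq_top T hS z

/-- The generators of the presented algebra as a sequence, extended by zero. -/
noncomputable def genSeq (K : Type*) [Field K] (n : ℕ) (i : ℕ) : Presented K n :=
  if h : i < 2 * n - 1 then gen K n ⟨i, h⟩ else 0

theorem genSeq_of_lt {i : ℕ} (h : i < 2 * n - 1) : genSeq K n i = gen K n ⟨i, h⟩ := dif_pos h

theorem mk_eq_zero_of_relator {r : Free K n} (hr : Relator K n r) :
    (LieSubmodule.Quotient.mk r : Presented K n) = 0 :=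
  LieSubmodule.Quotient.mk_eq_zero'.2 (LieSubmodule.subset_lieSpan hr)

theorem genSeq_chainRelations [CharP K 2] : ChainRelations (genSeq K n) (2 * n - 1) where
  symm := lie_comm_of_charTwo (K := K)
  comm i j hij hj := by
    rw [genSeq_of_lt hj, genSeq_of_lt (show i < _ by omega)]
    exact mk_eq_zero_of_relator (.comm ⟨i, by omega⟩ ⟨j, hj⟩ (.inl hij))
  left i hi := by
    rw [genSeq_of_lt hi, genSeq_of_lt (show i < _ by omega)]
    exact sub_eq_zero.1 (mk_eq_zero_of_relator (.left ⟨i, by omega⟩ ⟨i + 1, hi⟩ rfl))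
  right i hi := by
    rw [genSeq_of_lt hi, genSeq_of_lt (show i < _ by omega)]
    exact sub_eq_zero.1 (mk_eq_zero_of_relator (.right ⟨i, by omega⟩ ⟨i + 1, hi⟩ rfl))
  triple i hi := by
    rw [genSeq_of_lt hi, genSeq_of_lt (show i < _ by omega),
      genSeq_of_lt (show i + 1 < _ by omega)]
    exact mk_eq_zero_of_relator
      (.triple ⟨i, by omega⟩ ⟨i + 1, by omega⟩ ⟨i + 2, hi⟩ rfl rfl)

theorem presented_mem_span_chain [CharP K 2] (z : Presented K n) :
    z ∈ Submodule.span K {y | ∃ a d, a + d < 2 * n - 1 ∧ chain (genSeq K n) a d = y} := by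
  refine presented_submodule_eq_top _ (fun i => ?_) (fun i s hs => ?_) z
  · rw [← genSeq_of_lt i.2]
    exact Submodule.subset_span ⟨i, 0, i.2, rfl⟩
  · induction hs using Submodule.span_induction with
    | mem y hy =>
      obtain ⟨a, d, h, rfl⟩ := hy
      rw [← genSeq_of_lt i.2]
      refine genSeq_chainRelations.lie_chain_mem (S := (Submodule.span K _).toAddSubgroup)
        (fun a d h => ?_) i.2 h
      exact Submodule.subset_span ⟨a, d, h, rfl⟩
    | zero => rw [lie_zero]; exact Submodule.zero_mem _
    | add x y _ _ hx hy => rw [lie_add]; exact Submodule.add_mem _ hx hy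
    | smul c x _ hx => rw [lie_smul]; exact Submodule.smul_mem _ c hx

/-! ### The isomorphism with the derived algebra. -/

variable [CharP K 2]

/-- The map from the free Lie algebra sending the generators to the `X_i`. -/
noncomputable def freeToDerived (K : Type*) [Field K] [CharP K 2] (n : ℕ) :
    Free K n →ₗ⁅K⁆ oI1 K n :=
  FreeLieAlgebra.lift K fun i : Fin (2 * n - 1) =>
    symUnitDerived K (a := ⟨i, by omega⟩) (b := ⟨i + 1, by omega⟩) (by simp)

theorem oI1Incl_freeToDerived_x (i : Fin (2 * n - 1)) :
    oI1Incl K n (freeToDerived K n (x K n i)) =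
      symUnit K ⟨i, by omega⟩ ⟨i + 1, by omega⟩ := by
  rw [freeToDerived, FreeLieAlgebra.lift_of_apply, oI1Incl_symUnitDerived]

theorem freeToDerived_relator {r : Free K n} (hr : Relator K n r) : freeToDerived K n r = 0 := by
  apply oI1Incl_injective
  rw [map_zero]
  cases hr with
  | comm i j h =>
    simp only [LieHom.map_lie, oI1Incl_lie, oI1Incl_freeToDerived_x]
    apply symUnit_lie_disjoint <;> simp only [ne_eq, Fin.mk.injEq] <;> omega
  | left i j h =>
    simp only [map_sub, LieHom.map_lie, oI1Incl_lie, oI1Incl_freeToDerived_x, h]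
    rw [symUnit_lie_adjacent, symUnit_comm _ (⟨i + 1, _⟩ : Fin (2 * n)), symUnit_lie_adjacent,
      sub_self] <;> simp <;> omega
  | right i j h =>
    simp only [map_sub, LieHom.map_lie, oI1Incl_lie, oI1Incl_freeToDerived_x, h]
    rw [symUnit_lie_adjacent, symUnit_comm (⟨i, _⟩ : Fin (2 * n)) ⟨i + 1 + 1, _⟩,
      symUnit_lie_adjacent,
      symUnit_comm, sub_self] <;> simp <;> omega
  | triple i j k hij hjk =>
    simp only [LieHom.map_lie, oI1Incl_lie, oI1Incl_freeToDerived_x, hij, hjk]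
    rw [symUnit_lie_adjacent, symUnit_lie_adjacent, symUnit_lie_disjoint] <;> simp <;> omega

theorem relIdeal_le_ker : relIdeal K n ≤ (freeToDerived K n).ker :=
  LieSubmodule.lieSpan_le.2 fun _ hr => LieHom.mem_ker.2 (freeToDerived_relator hr)

/-- The map from the presented algebra sending the generators to the `X_i`. -/
noncomputable def presentedToDerived (K : Type*) [Field K] [CharP K 2] (n : ℕ) :
    Presented K n →ₗ⁅K⁆ oI1 K n :=
  { (relIdeal K n).toSubmodule.liftQ (freeToDerived K n : Free K n →ₗ[K] oI1 K n)
      (fun _ hz => relIdeal_le_ker hz) with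
    map_lie' := fun {a b} => by
      obtain ⟨a, rfl⟩ := LieSubmodule.Quotient.surjective_mk' _ a
      obtain ⟨b, rfl⟩ := LieSubmodule.Quotient.surjective_mk' _ b
      exact (freeToDerived K n).map_lie a b }

theorem oI1Incl_presentedToDerived_gen (i : Fin (2 * n - 1)) :
    oI1Incl K n (presentedToDerived K n (gen K n i)) =
      symUnit K ⟨i, by omega⟩ ⟨i + 1, by omega⟩ :=
  oI1Incl_freeToDerived_x i

theorem oI1Incl_presentedToDerived_chain {a d : ℕ} (h : a + d < 2 * n - 1) :
    oI1Incl K n (presentedToDerived K n (chain (genSeq K n) a d)) =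
      symUnit K ⟨a, by omega⟩ ⟨a + d + 1, by omega⟩ := by
  induction d with
  | zero => rw [chain, genSeq_of_lt (show a < 2 * n - 1 from h), oI1Incl_presentedToDerived_gen]
  | succ d ih =>
    rw [chain, LieHom.map_lie, oI1Incl_lie, ih (by omega),
      genSeq_of_lt (show a + d + 1 < 2 * n - 1 from h),
      oI1Incl_presentedToDerived_gen]
    apply symUnit_lie_adjacent <;> simp only [ne_eq, Fin.mk.injEq] <;> omega

/-- The linear map sending `E_{a,b} + E_{b,a}` with `a < b` to the corresponding chain. -/
noncomputable def matrixToPresented (K : Type*) [Field K] (n : ℕ) :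
    Matrix (Fin (2 * n)) (Fin (2 * n)) K →ₗ[K] Presented K n :=
  -- Since `chain g a d` sits at `(a, a + d + 1)`, position `(i, j)` needs `d = j - i - 1`; the
  -- truncated subtraction is exact for `i < j`.
  ∑ i : Fin (2 * n), ∑ j : Fin (2 * n), if i < j then
    (Matrix.entryLinearMap K K i j).smulRight (chain (genSeq K n) i (j - i - 1)) else 0

omit [CharP K 2] in
theorem matrixToPresented_symUnit {a b : Fin (2 * n)} (hab : a < b) :
    matrixToPresented K n (symUnit K a b) = chain (genSeq K n) a (b - a - 1) := by
  simp only [matrixToPresented, LinearMap.sum_apply]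
  rw [Finset.sum_eq_single a, Finset.sum_eq_single b]
  · simp [hab, symUnit, hab.ne, hab.ne']
  · intro j _ hj
    split_ifs with h
    · simp [symUnit, hj.symm, hab.ne']
    · rfl
  · simp
  · intro i _ hi
    refine Finset.sum_eq_zero fun j _ => ?_
    split_ifs with h
    · have : ¬ (b = i ∧ a = j) := by rintro ⟨rfl, rfl⟩; exact h.not_gt hab
      simp [symUnit, hi.symm, this]
    · rfl
  · simp

theorem matrixToPresented_presentedToDerived (z : Presented K n) :
    matrixToPresented K n (oI1Incl K n (presentedToDerived K n z)) = z := by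
  have hz := presented_mem_span_chain z
  induction hz using Submodule.span_induction with
  | mem y hy =>
    obtain ⟨a, d, h, rfl⟩ := hy
    rw [oI1Incl_presentedToDerived_chain h, matrixToPresented_symUnit (Fin.mk_lt_mk.2 (by omega))]
    congr 1
    simp only
    omega
  | zero => simp
  | add x y _ _ hx hy => rw [map_add, map_add, map_add, hx, hy]
  | smul c x _ hx => rw [map_smul, map_smul, map_smul, hx]

theorem presentedToDerived_surjective : Function.Surjective (presentedToDerived K n) := by
  intro b
  suffices h : oI1Incl K n b ∈
      LinearMap.range (oI1Incl K n ∘ₗ (presentedToDerived K n : Presented K n →ₗ[K] oI1 K n)) by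
    obtain ⟨z, hz⟩ := h
    exact ⟨z, oI1Incl_injective hz⟩
  rw [eq_sum_symUnit (oI1Incl_isSymm b) (oI1Incl_diag b)]
  refine Submodule.sum_mem _ fun i _ => Submodule.sum_mem _ fun j _ => ?_
  split_ifs with hij
  · refine Submodule.smul_mem _ _ ⟨chain (genSeq K n) i (j - i - 1), ?_⟩
    have hij' : (i : ℕ) < j := hij
    refine (oI1Incl_presentedToDerived_chain (by omega)).trans ?_
    congr 1
    ext
    simp only
    omega
  · exact Submodule.zero_mem _

theorem presentedToDerived_bijective : Function.Bijective (presentedToDerived K n) :=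
  ⟨Function.LeftInverse.injective (g := fun b => matrixToPresented K n (oI1Incl K n b))
    matrixToPresented_presentedToDerived, presentedToDerived_surjective⟩

end Presentation
end OrthogonalPresentation

theorem theorem8p4 (K : Type*) [Field K] [CharP K 2] (n : ℕ) (hn : 2 ≤ n) :
    -- `𝔬_I^{(1)}(2n)` consists of the symmetric zero-diagonal matrices
    (∀ A : Matrix (Fin (2 * n)) (Fin (2 * n)) K,
      (∃ a : OrthogonalPresentation.oI1 K n, ((a : OrthogonalPresentation.oI K n) :
          Matrix (Fin (2 * n)) (Fin (2 * n)) K) = A) ↔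
        (A.IsSymm ∧ ∀ i, A i i = 0)) ∧
    -- and it is presented by the generators `X_i` and the given relations
    ∃ e : OrthogonalPresentation.Presented K n ≃ₗ⁅K⁆ OrthogonalPresentation.oI1 K n,
      ∀ i : Fin (2 * n - 1),
        ((e (OrthogonalPresentation.gen K n i) : OrthogonalPresentation.oI K n) :
          Matrix (Fin (2 * n)) (Fin (2 * n)) K) = OrthogonalPresentation.X K n i :=
  ⟨OrthogonalPresentation.exists_oI1Incl_eq_iff,
    LieEquiv.ofBijective (OrthogonalPresentation.presentedToDerived K n)
      OrthogonalPresentation.presentedToDerived_bijective,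
    OrthogonalPresentation.oI1Incl_presentedToDerived_gen⟩
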